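/- **Definitions.** Let $m,n'\ge 2$ and let $\pi$ be a partition of $\{0,\dots,m-1\}\times\{0,\dots,n'-1\}$, with associated equivalence relation $\sim$. Let $$\Gamma_\pi=\langle a_0,\dots,a_{m-1},b_0,\dots,b_{n'-1}\mid a_0=b_0=1,\ a_ib_j=a_kb_l \text{ whenever } (i,j)\sim(k,l)\rangle .$$ The partition $\pi$ is *nondegenerate* if $a_0,\dots,a_{m-1}$ are distinct in $\Gamma_\pi$ and $b_0,\dots,b_{n'-1}$ are distinct in $\Gamma_\pi$. For a division ring $K$ and nonzero $r_i,s_j\in K$, it is *realizable with* $(r_i),(s_j)$ if for every class $E$ of $\pi$ the sum $\sum_{(i,j)\in E}r_is_j$ is $1$ if $(0,0)\in E$ and $0$ otherwise; it is *minimally realizable over* $K$ if for some nonzero $(r_i),(s_j)$ it is minimal (with respect to refinement) among the partitions realizable with $(r_i),(s_j)$. It is *row connected* if the equivalence relation on $\{0,\dots,m-1\}$ generated by $i\sim_r k$ whenever $(i,j)\sim(k,l)$ for some $j,l$ has only one class, and *column connected* if the analogous condition holds for columns. $\mathrm{ULIE}^{(1)}_K(m,n')$ is the set of groups $\Gamma_\pi$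 (up to isomorphism) for $\pi$ nondegenerate, minimally realizable over $K$, row connected and column connected. **Statement.** Let $n\ge 2$, and let $\pi$ be the partition of $\{0,\dots,2n\}\times\{0,\dots,2n\}$ generated by the pairings * $(0,1)\sim(1,0)$, $(0,2)\sim(2,0)$, $(1,1)\sim(2,2)$, $(1,2)\sim(2,1)$; * $(2p-1,2q-1)\sim(2p,2q)$ and $(2p-1,2q)\sim(2p,2q-1)$ for $2\le p,q\le n$; * $(0,j)\sim(j,2)$, $(1,j)\sim(j,0)$, $(2,j)\sim(j,1)$ for $3\le j\le 2n$. Then: 1. $\{(0,0)\}$ is a class of $\pi$ and every other class has exactly two elements. 2. $\pi$ is nondegenerate, minimally realizable over $\mathbb F_2$, row connected and column connected; so $\Gamma_\pi$ belongs to $\mathrm{ULIE}^{(1)}_{\mathbb F_2}(2n+1,2n+1)$. 3. There is an isomorphism $$\Gamma_\pi\;\cong\;\mathbb Z_2\times\Big((\mathbb Z_2\times\mathbb Z_2)\rtimes(\underbrace{\mathbb Z*\cdots*\mathbb Z}_{n-1})\Big),$$ where the generator of each free factor $\mathbb Z$ acts by the same automorphism $\alpha$ of $\mathbb Z_2\times\mathbb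 Z_2$, of order $3$, that cycles the nontrivial elements: $(0,1)\mapsto(1,0)\mapsto(1,1)\mapsto(0,1)$. It can be chosen so that $s=a_1^{-1}a_2$ and $a_1$ correspond to the generators $(1,0)$ and $(0,1)$ of $\mathbb Z_2\times\mathbb Z_2$, the elements $a_3,a_5,\dots,a_{2n-1}$ correspond to the generators of the $n-1$ free factors, and $t=a_{j}^{-1}a_{j+1}$ (the same element for all odd $j$ with $3\le j\le 2n-1$) corresponds to the generator of the first factor $\mathbb Z_2$. 4. If $n\ge3$, then $\Gamma_\pi$ is not amenable. 5. $\Gamma_\pi$ is sofic. -/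

import Mathlib

namespace ULIE

/-! Partitions of the grid `Fin m × Fin n` are given by setoids; `π ≤ σ` in the order of setoids
means that `π` is finer than `σ`. -/

section General

/-- The defining relators: `a₀ = 1`, `b₀ = 1`, and `aᵢ bⱼ = aₖ bₗ` whenever `(i,j) ∼ (k,l)`.
The generator `aᵢ` is `Sum.inl i` and the generator `bⱼ` is `Sum.inr j`. -/
def relators {m n : ℕ} (π : Setoid (Fin m × Fin n)) : Set (FreeGroup (Fin m ⊕ Fin n)) :=
  {w | (∃ i : Fin m, i.val = 0 ∧ w = FreeGroup.of (Sum.inl i)) ∨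
    (∃ j : Fin n, j.val = 0 ∧ w = FreeGroup.of (Sum.inr j)) ∨
    ∃ x y : Fin m × Fin n, π x y ∧
      w = FreeGroup.of (Sum.inl x.1) * FreeGroup.of (Sum.inr x.2) *
        (FreeGroup.of (Sum.inl y.1) * FreeGroup.of (Sum.inr y.2))⁻¹}

/-- The group `Γ_π`. -/
abbrev Gam {m n : ℕ} (π : Setoid (Fin m × Fin n)) : Type := PresentedGroup (relators π)

/-- The canonical generator `aᵢ` of `Γ_π`. -/
def a {m n : ℕ} (π : Setoid (Fin m × Fin n)) (i : Fin m) : Gam π := PresentedGroup.of (Sum.inl i)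

/-- The canonical generator `bⱼ` of `Γ_π`. -/
def b {m n : ℕ} (π : Setoid (Fin m × Fin n)) (j : Fin n) : Gam π := PresentedGroup.of (Sum.inr j)

/-- `π` is nondegenerate: the `aᵢ` are distinct and the `bⱼ` are distinct in `Γ_π`. -/
def Nondegenerate {m n : ℕ} (π : Setoid (Fin m × Fin n)) : Prop :=
  Function.Injective (a π) ∧ Function.Injective (b π)

open Classical in
/-- `π` is realizable with the nonzero elements `r₀, …, r_{m-1}, s₀, …, s_{n-1}` of `K`: the sum of
`rᵢ sⱼ` over a class is `1` for the class of `(0,0)` and `0` for every other class. -/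
def RealizableWith {K : Type*} [DivisionRing K] {m n : ℕ} [NeZero m] [NeZero n]
    (r : Fin m → K) (s : Fin n → K) (π : Setoid (Fin m × Fin n)) : Prop :=
  (∀ i, r i ≠ 0) ∧ (∀ j, s j ≠ 0) ∧
    ∀ x : Fin m × Fin n,
      ∑ y ∈ Finset.univ.filter (fun y => π x y), r y.1 * s y.2 = if π x (0, 0) then 1 else 0

/-- `π` is minimally realizable over `K`: for some `r, s` it is minimal among the partitions that
are realizable with `r, s`. -/
def MinimallyRealizable (K : Type*) [DivisionRing K] {m n : ℕ} [NeZero m] [NeZero n]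
    (π : Setoid (Fin m × Fin n)) : Prop :=
  ∃ (r : Fin m → K) (s : Fin n → K), Minimal (RealizableWith r s) π

/-- `π` is row connected. -/
def RowConnected {m n : ℕ} (π : Setoid (Fin m × Fin n)) : Prop :=
  ∀ i i' : Fin m, Relation.EqvGen (fun k k' => ∃ j j' : Fin n, π (k, j) (k', j')) i i'

/-- `π` is column connected. -/
def ColumnConnected {m n : ℕ} (π : Setoid (Fin m × Fin n)) : Prop :=
  ∀ j j' : Fin n, Relation.EqvGen (fun l l' => ∃ i i' : Fin m, π (i, l) (i', l')) j j'

/-- The partitions `π` whose groups `Γ_π` make up `ULIE⁽¹⁾_K(m,n)`. -/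
structure IsULIE1Partition (K : Type*) [DivisionRing K] {m n : ℕ} [NeZero m] [NeZero n]
    (π : Setoid (Fin m × Fin n)) : Prop where
  two_le_left : 2 ≤ m
  two_le_right : 2 ≤ n
  nondegenerate : Nondegenerate π
  minimallyRealizable : MinimallyRealizable K π
  rowConnected : RowConnected π
  columnConnected : ColumnConnected π

/-- `G` is (up to isomorphism) a member of `ULIE⁽¹⁾_K(m,n)`. -/
def IsULIE1Group (K : Type*) [DivisionRing K] (m n : ℕ) [NeZero m] [NeZero n]
    (G : Type*) [Group G] : Prop :=
  ∃ π : Setoid (Fin m × Fin n), IsULIE1Partition K π ∧ Nonempty (G ≃* Gam π)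

/-- `π` consists of the singleton `{(0,0)}` and of pairs. -/
def IsPairPartition {m n : ℕ} [NeZero m] [NeZero n] (π : Setoid (Fin m × Fin n)) : Prop :=
  {y | π (0, 0) y} = {(0, 0)} ∧ ∀ x : Fin m × Fin n, x ≠ (0, 0) → {y | π x y}.ncard = 2

/-- Amenability of a discrete group: there is a left-invariant finitely additive probability
measure on the set of all subsets. -/
def IsAmenable (G : Type*) [Group G] : Prop :=
  ∃ μ : Set G → ℝ, (∀ A, 0 ≤ μ A) ∧ μ Set.univ = 1 ∧
    (∀ A B, Disjoint A B → μ (A ∪ B) = μ A + μ B) ∧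
    ∀ (g : G) (A : Set G), μ ((fun x => g * x) '' A) = μ A

/-- The normalized Hamming distance of two permutations of an `N`-element set. -/
noncomputable def permDist {N : ℕ} (p q : Equiv.Perm (Fin N)) : ℝ :=
  (hammingDist (p : Fin N → Fin N) (q : Fin N → Fin N) : ℝ) / N

/-- Soficity: every finite subset has almost multiplicative, almost free actions on nonempty finite
sets, in the normalized Hamming distance. -/
def IsSofic (G : Type*) [Group G] : Prop :=
  ∀ (F : Finset G) (ε : ℝ), 0 < ε →
    ∃ (N : ℕ) (σ : G → Equiv.Perm (Fin N)), 0 < N ∧ σ 1 = 1 ∧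
      (∀ g ∈ F, ∀ h ∈ F, permDist (σ (g * h)) (σ g * σ h) ≤ ε) ∧
      ∀ g ∈ F, g ≠ 1 → 1 - ε ≤ permDist (σ g) 1

end General

section Family

/-- The pairs of the partition of the `(2n+1) × (2n+1)` grid, rows and columns numbered from `0`. -/
inductive GridPair (n : ℕ) : ℕ × ℕ → ℕ × ℕ → Prop
  | corner_one : GridPair n (0, 1) (1, 0)
  | corner_two : GridPair n (0, 2) (2, 0)
  | cross_diag : GridPair n (1, 1) (2, 2)
  | cross_anti : GridPair n (1, 2) (2, 1)
  | block_diag (p q : ℕ) (hp : 2 ≤ p ∧ p ≤ n) (hq : 2 ≤ q ∧ q ≤ n) :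
      GridPair n (2 * p - 1, 2 * q - 1) (2 * p, 2 * q)
  | block_anti (p q : ℕ) (hp : 2 ≤ p ∧ p ≤ n) (hq : 2 ≤ q ∧ q ≤ n) :
      GridPair n (2 * p - 1, 2 * q) (2 * p, 2 * q - 1)
  | row_zero (j : ℕ) (hj : 3 ≤ j ∧ j ≤ 2 * n) : GridPair n (0, j) (j, 2)
  | row_one (j : ℕ) (hj : 3 ≤ j ∧ j ≤ 2 * n) : GridPair n (1, j) (j, 0)
  | row_two (j : ℕ) (hj : 3 ≤ j ∧ j ≤ 2 * n) : GridPair n (2, j) (j, 1)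

/-- The partition `π` of the `(2n+1) × (2n+1)` grid generated by these pairs. -/
def gridPartition (n : ℕ) : Setoid (Fin (2 * n + 1) × Fin (2 * n + 1)) :=
  Relation.EqvGen.setoid fun x y => GridPair n (x.1.val, x.2.val) (y.1.val, y.2.val)

/-- The cyclic group of order two, written multiplicatively. -/
abbrev C2 : Type := Multiplicative (ZMod 2)

/-- The generator of the cyclic group of order two. -/
def c : C2 := Multiplicative.ofAdd 1

/-- The automorphism of `C2 × C2` that cycles the nontrivial elements:
`(1, c) ↦ (c, 1) ↦ (c, c) ↦ (1, c)`. -/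
def alpha : MulAut (C2 × C2) where
  toFun v := (v.1 * v.2, v.1)
  invFun v := (v.2, v.1 * v.2)
  left_inv := by decide
  right_inv := by decide
  map_mul' := by decide

/-- The free product of `k` copies of `ℤ`. -/
abbrev FreeProdZ (k : ℕ) : Type := Monoid.CoprodI fun _ : Fin k => Multiplicative ℤ

/-- The generator of the `i`-th free factor. -/
def gen {k : ℕ} (i : Fin k) : FreeProdZ k :=
  Monoid.CoprodI.of (M := fun _ : Fin k => Multiplicative ℤ) (i := i) (Multiplicative.ofAdd 1)

/-- The action of the free product in which the generator of each factor acts by `alpha`. -/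
def act (k : ℕ) : FreeProdZ k →* MulAut (C2 × C2) :=
  Monoid.CoprodI.lift fun _ : Fin k => zpowersHom (MulAut (C2 × C2)) alpha

/-- The group `ℤ₂ × ((ℤ₂ × ℤ₂) ⋊ (ℤ * ⋯ * ℤ))` with `k` free factors. -/
abbrev Model (k : ℕ) : Type := C2 × ((C2 × C2) ⋊[act k] FreeProdZ k)

end Family

end ULIE

/-! Both `Γ_π` and the model group are universal for families of elements `t`, `s`, `a`,
`x₁, …, x_k` such that `t`, `s`, `a` are commuting involutions, `t` commutes with each `xᵢ`, and
conjugation by `xᵢ` maps `a ↦ s ↦ sa`. For `Γ_π` one takes `t = a₃⁻¹a₄`, `s = a₁⁻¹a₂`, `a = a₁` and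
`xᵢ = a₃, a₅, …`; the pairs in the rows `0`, `1`, `2` eliminate the `bⱼ` and give the relations of
the `xᵢ` with `s` and `a`, while the `2 × 2` blocks say that `t = a_j⁻¹a_{j+1}` for all odd `j ≥ 3`
and that `t` is a central involution. Nondegeneracy is then read off in the model group.

In characteristic `2`, a class of two elements sums to `0` for `r = s = 1`, while a one-element
class sums to `1`; so a partition into `{(0,0)}` and pairs is minimally realizable.

The model group maps onto a free group of rank `k`, which is not amenable for `k ≥ 2`. Free groups
are residually finite: left multiplications on the finite set of suffixes of a reduced word extend
to permutations. Residual finiteness passes to semidirect products with finite kernel, which embed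
in the product of the acting group and a finite holomorph, and it implies soficity. -/

namespace ULIE

section ResiduallyFinite

theorem residuallyFinite_of_injective {G H : Type*} [Group G] [Group H] [Group.ResiduallyFinite H]
    (f : G →* H) (hf : Function.Injective f) : Group.ResiduallyFinite G := by
  rw [Group.residuallyFinite_iff_forall_finiteIndexNormalSubgroup]
  intro g hg
  exact (injective_iff_map_eq_one f).mp hf g <|
    Group.eq_one_iff_forall_finiteIndexNormalSubroup (f g) fun K ↦ hg (K.comap f)

theorem exists_perm_extending_mul {G : Type*} [Group G] (S : Set G) [Finite S] (g : G) :
    ∃ σ : Equiv.Perm S, ∀ x : S, g * x ∈ S → (σ x : G) = g * x := by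
  classical
  have := Fintype.ofFinite S
  let e : {x : S // g * x ∈ S} ≃ {y : S // g⁻¹ * y ∈ S} :=
    { toFun x := ⟨⟨g * x, x.2⟩, by simp⟩
      invFun y := ⟨⟨g⁻¹ * y, y.2⟩, by simp⟩
      left_inv x := by simp
      right_inv y := by simp }
  exact ⟨e.extendSubtype, fun x hx ↦ by rw [e.extendSubtype_apply_of_mem x hx]; rfl⟩

theorem coe_perm_inv_apply_of_extending_mul {G : Type*} [Group G] {S : Set G} {g : G}
    {σ : Equiv.Perm S} (hσ : ∀ x : S, g * x ∈ S → (σ x : G) = g * x) (x : S)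
    (hx : g⁻¹ * x ∈ S) : (σ⁻¹ x : G) = g⁻¹ * x := by
  have : σ ⟨_, hx⟩ = x := Subtype.ext <| by simp [hσ ⟨_, hx⟩]
  exact congrArg Subtype.val (Equiv.Perm.inv_eq_iff_eq.mpr this.symm)

theorem freeGroup_lift_mk_apply_one {α : Type*} {S : Set (FreeGroup α)} (h1 : 1 ∈ S)
    {σ : α → Equiv.Perm S} (hσ : ∀ (i : α) (x : S), FreeGroup.of i * (x : FreeGroup α) ∈ S →
      (σ i x : FreeGroup α) = FreeGroup.of i * x)
    (L : List (α × Bool)) (hL : ∀ L', L' <:+ L → FreeGroup.mk L' ∈ S) :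
    (FreeGroup.lift σ (FreeGroup.mk L) ⟨1, h1⟩ : FreeGroup α) = FreeGroup.mk L := by
  induction L with
  | nil => rfl
  | cons l L ih =>
    have hcons : FreeGroup.mk (l :: L) = FreeGroup.mk [l] * FreeGroup.mk L := by simp
    have hmem := hL (l :: L) List.suffix_rfl
    have hval := ih fun L' h ↦ hL L' (h.trans (List.suffix_cons l L))
    rw [hcons, ← hval] at hmem
    rw [hcons, map_mul, Equiv.Perm.mul_apply]
    conv_rhs => rw [← hval]
    obtain ⟨i, _ | _⟩ := l
    · have hmk : FreeGroup.mk [(i, false)] = (FreeGroup.of i)⁻¹ := rfl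
      rw [hmk] at hmem ⊢
      rw [map_inv, FreeGroup.lift_apply_of]
      exact coe_perm_inv_apply_of_extending_mul (hσ i) _ hmem
    · have hmk : FreeGroup.mk [(i, true)] = FreeGroup.of i := rfl
      rw [hmk] at hmem ⊢
      rw [FreeGroup.lift_apply_of]
      exact hσ i _ hmem

instance residuallyFinite_freeGroup (α : Type*) : Group.ResiduallyFinite (FreeGroup α) := by
  refine Group.residuallyFinite_of_forall_exists_finite_monoidHom fun w hw ↦ ?_
  obtain ⟨L, rfl⟩ := Quot.exists_rep w
  let S : Set (FreeGroup α) := FreeGroup.mk '' {L' | L' ∈ L.tails}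
  have hS : ∀ L', L' <:+ L → FreeGroup.mk L' ∈ S := fun L' h ↦ ⟨L', (List.mem_tails ..).mpr h, rfl⟩
  have : Finite S := (L.tails.finite_toSet.image _).to_subtype
  choose σ hσ using fun i : α ↦ exists_perm_extending_mul S (FreeGroup.of i)
  have key := freeGroup_lift_mk_apply_one (hS [] L.nil_suffix) hσ L hS
  refine ⟨Equiv.Perm S, inferInstance, inferInstance, FreeGroup.lift σ, fun h ↦ hw ?_⟩
  exact key.symm.trans (congrArg (fun τ : Equiv.Perm S ↦ (τ ⟨1, _⟩ : FreeGroup α)) h)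

instance residuallyFinite_semidirectProduct {N G : Type*} [Group N] [Finite N] [Group G]
    [Group.ResiduallyFinite G] (φ : G →* MulAut N) : Group.ResiduallyFinite (N ⋊[φ] G) := by
  have : Finite (MulAut N) := Finite.of_injective _ DFunLike.coe_injective
  have : Finite (N ⋊[MonoidHom.id (MulAut N)] MulAut N) :=
    Finite.of_equiv _ SemidirectProduct.equivProd.symm
  let toHolomorph : N ⋊[φ] G →* N ⋊[MonoidHom.id (MulAut N)] MulAut N :=
    SemidirectProduct.map (MonoidHom.id N) φ fun _ ↦ rfl
  refine residuallyFinite_of_injective (toHolomorph.prod SemidirectProduct.rightHom) ?_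
  intro g h hgh
  have hleft := congrArg (fun z ↦ z.1.left) hgh
  exact SemidirectProduct.ext hleft (congrArg Prod.snd hgh)

end ResiduallyFinite

section Sofic

theorem permDist_self {N : ℕ} (p : Equiv.Perm (Fin N)) : permDist p p = 0 := by
  simp [permDist]

theorem permDist_eq_one {N : ℕ} [NeZero N] {p q : Equiv.Perm (Fin N)} (h : ∀ i, p i ≠ q i) :
    permDist p q = 1 := by
  have hdist : hammingDist (p : Fin N → Fin N) q = N := by simp [hammingDist, h]
  rw [permDist, hdist, div_self (NeZero.ne (N : ℝ))]

theorem exists_finiteIndexNormalSubgroup_forall_notMem {G : Type*} [Group G]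
    [Group.ResiduallyFinite G] (F : Finset G) :
    ∃ K : FiniteIndexNormalSubgroup G, ∀ g ∈ F, g ≠ 1 → g ∉ K := by
  classical
  induction F using Finset.induction_on with
  | empty => exact ⟨.ofSubgroup ⊤, by simp⟩
  | insert x F _ ih =>
    obtain ⟨K, hK⟩ := ih
    by_cases hx : x = 1
    · exact ⟨K, by simp_all⟩
    · obtain ⟨H, hH⟩ := Group.exists_finiteIndexNormalSubgroup_notMem x hx
      refine ⟨H ⊓ K, fun g hg hg1 hgHK ↦ ?_⟩
      rcases Finset.mem_insert.mp hg with rfl | hg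
      exacts [hH hgHK.1, hK g hg hg1 hgHK.2]

theorem isSofic_of_residuallyFinite (G : Type*) [Group G] [Group.ResiduallyFinite G] :
    IsSofic G := by
  intro F ε hε
  obtain ⟨K, hK⟩ := exists_finiteIndexNormalSubgroup_forall_notMem F
  let Q := G ⧸ K.toSubgroup
  let e : Q ≃ Fin (Nat.card Q) := Finite.equivFin Q
  have : NeZero (Nat.card Q) := ⟨Nat.card_pos.ne'⟩
  let σ : G →* Equiv.Perm (Fin (Nat.card Q)) :=
    (e.permCongrHom.toMonoidHom.comp (MulAction.toPermHom Q Q)).comp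
      (QuotientGroup.mk' K.toSubgroup)
  refine ⟨_, σ, Nat.card_pos, map_one σ, fun g _ h _ ↦ ?_, fun g hg hg1 ↦ ?_⟩
  · rw [map_mul, permDist_self]
    exact hε.le
  · have hfree : ∀ i, σ g i ≠ i := by
      intro i hi
      have hfix : (g : Q) * e.symm i = e.symm i := e.eq_symm_apply.mpr hi
      rw [mul_eq_right, QuotientGroup.eq_one_iff] at hfix
      exact hK g hg hg1 hfix
    rw [permDist_eq_one hfree]
    linarith

end Sofic

section Amenable

/-- `μ` is a left-invariant finitely additive probability measure on the subsets of `G`; amenability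
of `G` is the existence of such a `μ`. -/
structure IsInvariantMean {G : Type*} [Group G] (μ : Set G → ℝ) : Prop where
  nonneg : ∀ A, 0 ≤ μ A
  univ : μ Set.univ = 1
  union : ∀ A B, Disjoint A B → μ (A ∪ B) = μ A + μ B
  image_mul_left : ∀ (g : G) (A : Set G), μ ((fun x ↦ g * x) '' A) = μ A

theorem isAmenable_iff {G : Type*} [Group G] :
    IsAmenable G ↔ ∃ μ : Set G → ℝ, IsInvariantMean μ :=
  ⟨fun ⟨μ, h₁, h₂, h₃, h₄⟩ ↦ ⟨μ, h₁, h₂, h₃, h₄⟩, fun ⟨μ, h₁, h₂, h₃, h₄⟩ ↦ ⟨μ, h₁, h₂, h₃, h₄⟩⟩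

namespace IsInvariantMean

variable {G : Type*} [Group G] {μ : Set G → ℝ}

theorem mono (hμ : IsInvariantMean μ) {A B : Set G} (h : A ⊆ B) : μ A ≤ μ B := by
  rw [← Set.union_sdiff_cancel h, hμ.union _ _ Set.disjoint_sdiff_right]
  exact le_add_of_nonneg_right (hμ.nonneg _)

theorem le_one (hμ : IsInvariantMean μ) (A : Set G) : μ A ≤ 1 :=
  hμ.univ ▸ hμ.mono A.subset_univ

theorem add_compl (hμ : IsInvariantMean μ) (A : Set G) : μ A + μ Aᶜ = 1 := by
  rw [← hμ.union _ _ disjoint_compl_right, Set.union_compl_self, hμ.univ]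

theorem preimage {H : Type*} [Group H] (hμ : IsInvariantMean μ) {f : G →* H}
    (hf : Function.Surjective f) : IsInvariantMean fun A ↦ μ (f ⁻¹' A) where
  nonneg _ := hμ.nonneg _
  univ := hμ.univ
  union _ _ h := hμ.union _ _ (h.preimage f)
  image_mul_left h A := by
    obtain ⟨g, rfl⟩ := hf h
    rw [← hμ.image_mul_left g (f ⁻¹' A)]
    congr 1
    ext x
    simp [Set.image_mul_left]

theorem one_le_startsWith {α : Type*} [DecidableEq α] {μ : Set (FreeGroup α) → ℝ}
    (hμ : IsInvariantMean μ) (i : α) :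
    1 ≤ μ (FreeGroup.startsWith (i, true) ∪ FreeGroup.startsWith (i, false)) := by
  have hsub : (fun x ↦ FreeGroup.mk [(i, true)] * x) '' (FreeGroup.startsWith (i, false))ᶜ ⊆
      FreeGroup.startsWith (i, true) :=
    Set.image_subset_iff.mpr fun x hx ↦ FreeGroup.startsWith_mk_mul x hx
  calc 1 = μ (FreeGroup.startsWith (i, false)) + μ (FreeGroup.startsWith (i, false))ᶜ :=
        (hμ.add_compl _).symm
    _ ≤ μ (FreeGroup.startsWith (i, false)) + μ (FreeGroup.startsWith (i, true)) := by
        rw [← hμ.image_mul_left (FreeGroup.mk [(i, true)]) (FreeGroup.startsWith (i, false))ᶜ]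
        exact add_le_add_right (hμ.mono hsub) _
    _ = μ (FreeGroup.startsWith (i, true) ∪ FreeGroup.startsWith (i, false)) := by
        rw [hμ.union _ _ (by simp), add_comm]

end IsInvariantMean

theorem IsAmenable.of_surjective {G H : Type*} [Group G] [Group H] (hG : IsAmenable G) (f : G →* H)
    (hf : Function.Surjective f) : IsAmenable H := by
  obtain ⟨μ, hμ⟩ := isAmenable_iff.mp hG
  exact isAmenable_iff.mpr ⟨_, hμ.preimage hf⟩

theorem not_isAmenable_freeGroup (α : Type*) [Nontrivial α] : ¬ IsAmenable (FreeGroup α) := by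
  classical
  intro h
  obtain ⟨μ, hμ⟩ := isAmenable_iff.mp h
  obtain ⟨i, j, hij⟩ := exists_pair_ne α
  have hdisj : Disjoint (FreeGroup.startsWith (i, true) ∪ FreeGroup.startsWith (i, false))
      (FreeGroup.startsWith (j, true) ∪ FreeGroup.startsWith (j, false)) := by
    simp [hij]
  have htotal := hμ.le_one _ |>.trans_eq' (hμ.union _ _ hdisj)
  linarith [hμ.one_le_startsWith i, hμ.one_le_startsWith j]

end Amenable

section FreeProduct

theorem freeProdZ_hom_ext {k : ℕ} {G : Type*} [Group G] {f g : FreeProdZ k →* G}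
    (h : ∀ i, f (gen i) = g (gen i)) : f = g :=
  Monoid.CoprodI.ext_hom _ _ fun i ↦ MonoidHom.ext_mint (h i)

theorem lift_zpowersHom_gen {k : ℕ} {G : Type*} [Group G] (x : Fin k → G) (i : Fin k) :
    Monoid.CoprodI.lift (fun i ↦ zpowersHom G (x i)) (gen i) = x i := by
  simp [gen]

/-- The free product of `k` infinite cyclic groups is the free group on the generators of its
factors. -/
def freeGroupEquivFreeProdZ (k : ℕ) : FreeGroup (Fin k) ≃* FreeProdZ k :=
  (FreeGroup.lift gen).toMulEquiv
    (Monoid.CoprodI.lift fun i ↦ zpowersHom (FreeGroup (Fin k)) (FreeGroup.of i))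
    (FreeGroup.ext_hom _ _ fun i ↦ by simp [lift_zpowersHom_gen])
    (freeProdZ_hom_ext fun i ↦ by simp [lift_zpowersHom_gen])

@[simp]
theorem freeGroupEquivFreeProdZ_of {k : ℕ} (i : Fin k) :
    freeGroupEquivFreeProdZ k (FreeGroup.of i) = gen i := by
  simp [freeGroupEquivFreeProdZ]

theorem gen_injective {k : ℕ} : Function.Injective (gen (k := k)) := by
  intro i j h
  rw [← freeGroupEquivFreeProdZ_of, ← freeGroupEquivFreeProdZ_of] at h
  exact FreeGroup.of_injective ((freeGroupEquivFreeProdZ k).injective h)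

theorem gen_ne_one {k : ℕ} (i : Fin k) : gen i ≠ 1 := by
  rw [← freeGroupEquivFreeProdZ_of, ne_eq, EmbeddingLike.map_eq_one_iff]
  exact FreeGroup.of_ne_one i

theorem closure_range_gen (k : ℕ) : Subgroup.closure (Set.range (gen (k := k))) = ⊤ := by
  rw [← FreeGroup.range_lift_eq_closure, MonoidHom.range_eq_top]
  exact (freeGroupEquivFreeProdZ k).surjective

instance residuallyFinite_freeProdZ (k : ℕ) : Group.ResiduallyFinite (FreeProdZ k) :=
  residuallyFinite_of_injective (freeGroupEquivFreeProdZ k).symm.toMonoidHom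
    (freeGroupEquivFreeProdZ k).symm.injective

theorem not_isAmenable_freeProdZ {k : ℕ} (hk : 2 ≤ k) : ¬ IsAmenable (FreeProdZ k) := by
  have : Nontrivial (Fin k) := Fin.nontrivial_iff_two_le.mpr hk
  exact fun h ↦ not_isAmenable_freeGroup (Fin k) <|
    h.of_surjective (freeGroupEquivFreeProdZ k).symm.toMonoidHom
      (freeGroupEquivFreeProdZ k).symm.surjective

end FreeProduct

section PairPartition

theorem eqvGen_iff_of_symmGen_unique {α : Type*} {r : α → α → Prop}
    (h : ∀ x y z, Relation.SymmGen r x y → Relation.SymmGen r x z → y = z) {x y : α} :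
    Relation.EqvGen r x y ↔ x = y ∨ Relation.SymmGen r x y := by
  refine ⟨fun hxy ↦ ?_, ?_⟩
  · induction hxy with
    | rel x y hxy => exact .inr (.inl hxy)
    | refl x => exact .inl rfl
    | symm x y _ ih => exact ih.imp Eq.symm Or.symm
    | trans x y z _ _ ihxy ihyz =>
      rcases ihxy with rfl | hxy
      · exact ihyz
      · rcases ihyz with rfl | hyz
        · exact .inr hxy
        · exact .inl (h y x z hxy.symm hyz)
  · rintro (rfl | hxy | hyx)
    exacts [.refl x, .rel _ _ hxy, .symm _ _ (.rel _ _ hyx)]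

section Realizability

variable {m n : ℕ} [NeZero m] [NeZero n] {π : Setoid (Fin m × Fin n)} {K : Type*} [DivisionRing K]

open Classical in
theorem realizableWith_one_iff :
    RealizableWith (1 : Fin m → K) 1 π ↔
      ∀ x, ({y | π x y}.ncard : K) = if π x (0, 0) then 1 else 0 := by
  have hsum : ∀ x : Fin m × Fin n, ({y | π x y}.ncard : K) =
      ∑ y ∈ Finset.univ.filter (fun y ↦ π x y), (1 : Fin m → K) y.1 * (1 : Fin n → K) y.2 := by
    intro x
    rw [Set.ncard_eq_toFinset_card']
    simp
  simp only [RealizableWith, hsum]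
  simp

theorem IsPairPartition.rel_zero_iff (hπ : IsPairPartition π) {x : Fin m × Fin n} :
    π x (0, 0) ↔ x = (0, 0) := by
  rw [Setoid.comm']
  exact Set.ext_iff.mp hπ.1 x

theorem IsPairPartition.minimallyRealizable [CharP K 2] (hπ : IsPairPartition π) :
    MinimallyRealizable K π := by
  refine ⟨1, 1, realizableWith_one_iff.mpr fun x ↦ ?_, fun σ hσ hle x y hxy ↦ ?_⟩
  · split_ifs with hx
    · rw [hπ.rel_zero_iff.mp hx, hπ.1, Set.ncard_singleton, Nat.cast_one]
    · rw [hπ.2 x (mt hπ.rel_zero_iff.mpr hx), Nat.cast_ofNat, CharTwo.two_eq_zero]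
  · by_cases hx : x = (0, 0)
    · subst hx
      rw [(Set.ext_iff.mp hπ.1 y).mp hxy]
    have hsub : {y | σ x y} ⊆ {y | π x y} := fun y hy ↦ hle hy
    have hcard := realizableWith_one_iff.mp hσ x
    rw [if_neg fun h ↦ hx (hπ.rel_zero_iff.mp (hle h))] at hcard
    have hpos : 0 < {y | σ x y}.ncard := (Set.ncard_pos).mpr ⟨x, σ.refl' x⟩
    have hne : {y | σ x y}.ncard ≠ 1 := fun h ↦ by simp [h] at hcard
    have heq := Set.eq_of_subset_of_ncard_le hsub (by rw [hπ.2 x hx]; omega)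
    exact (Set.ext_iff.mp heq y).mpr hxy

end Realizability

theorem isPairPartition_eqvGen {m n : ℕ} [NeZero m] [NeZero n]
    {r : Fin m × Fin n → Fin m × Fin n → Prop} (hne : ∀ x y, r x y → x ≠ y)
    (hunique : ∀ x y z, Relation.SymmGen r x y → Relation.SymmGen r x z → y = z)
    (hpartner : ∀ x, (∃ y, Relation.SymmGen r x y) ↔ x ≠ (0, 0)) :
    IsPairPartition (Relation.EqvGen.setoid r) := by
  have hrel : ∀ x y, Relation.EqvGen.setoid r x y ↔ x = y ∨ Relation.SymmGen r x y :=
    fun x y ↦ eqvGen_iff_of_symmGen_unique hunique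
  constructor
  · ext y
    have hzero : ¬ Relation.SymmGen r (0, 0) y := fun h ↦ (hpartner _).mp ⟨y, h⟩ rfl
    simp [hrel, hzero, eq_comm]
  · intro x hx
    obtain ⟨y, hxy⟩ := (hpartner x).mpr hx
    have hclass : {z | Relation.EqvGen.setoid r x z} = {x, y} := by
      ext z
      have hz : Relation.SymmGen r x z ↔ z = y := ⟨fun h ↦ hunique x z y h hxy, fun h ↦ h ▸ hxy⟩
      simp [hrel, hz, eq_comm (a := x)]
    rw [hclass, Set.ncard_pair (hxy.elim (hne x y) fun h ↦ (hne y x h).symm)]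

section Connectedness

variable {m n : ℕ} {π : Setoid (Fin m × Fin n)}

theorem rowConnected_of_forall_rel (i₀ : Fin m) (h : ∀ i, ∃ j j', π (i₀, j) (i, j')) :
    RowConnected π :=
  fun i i' ↦ .trans _ i₀ _ (.symm _ _ (.rel _ _ (h i))) (.rel _ _ (h i'))

theorem columnConnected_of_forall_rel (j₀ : Fin n) (h : ∀ j, ∃ i i', π (i, j₀) (i', j)) :
    ColumnConnected π :=
  fun j j' ↦ .trans _ j₀ _ (.symm _ _ (.rel _ _ (h j))) (.rel _ _ (h j'))

end Connectedness

end PairPartition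

section GridPartition

/-- The other element of the pair of the grid partition that contains a given position; the
position `(0, 0)` is fixed. -/
def mate (x : ℕ × ℕ) : ℕ × ℕ :=
  if x.1 ≤ 2 then
    if x.2 ≤ 2 then
      if x.1 = 0 ∨ x.2 = 0 then (x.2, x.1) else (3 - x.1, 3 - x.2)
    else (x.2, (x.1 + 2) % 3)
  else if x.2 ≤ 2 then ((x.2 + 1) % 3, x.1)
  else (if x.1 % 2 = 1 then x.1 + 1 else x.1 - 1, if x.2 % 2 = 1 then x.2 + 1 else x.2 - 1)

variable {n : ℕ}

theorem GridPair.mate_left {x y : ℕ × ℕ} (h : GridPair n x y) : mate x = y := by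
  cases h <;> unfold mate <;> grind

theorem GridPair.mate_right {x y : ℕ × ℕ} (h : GridPair n x y) : mate y = x := by
  cases h <;> unfold mate <;> grind

theorem GridPair.mate_eq_of_symmGen {x y : ℕ × ℕ} (h : Relation.SymmGen (GridPair n) x y) :
    mate x = y :=
  h.elim mate_left mate_right

theorem GridPair.ne {x y : ℕ × ℕ} (h : GridPair n x y) : x ≠ y := by
  cases h <;> grind

theorem GridPair.ne_zero {x y : ℕ × ℕ} (h : GridPair n x y) : x ≠ (0, 0) ∧ y ≠ (0, 0) := by
  cases h <;> grind

theorem GridPair.lt (hn : 1 ≤ n) {x y : ℕ × ℕ} (h : GridPair n x y) :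
    (x.1 < 2 * n + 1 ∧ x.2 < 2 * n + 1) ∧ y.1 < 2 * n + 1 ∧ y.2 < 2 * n + 1 := by
  cases h <;> dsimp only <;> omega

theorem exists_symmGen_gridPair {i j : ℕ} (hi : i ≤ 2 * n) (hj : j ≤ 2 * n)
    (h0 : (i, j) ≠ (0, 0)) : ∃ y, Relation.SymmGen (GridPair n) (i, j) y := by
  rcases le_or_gt i 2 with hi2 | hi2 <;> rcases le_or_gt j 2 with hj2 | hj2
  · interval_cases i <;> interval_cases j
    exacts [absurd rfl h0, ⟨_, .inl .corner_one⟩, ⟨_, .inl .corner_two⟩, ⟨_, .inr .corner_one⟩,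
      ⟨_, .inl .cross_diag⟩, ⟨_, .inl .cross_anti⟩, ⟨_, .inr .corner_two⟩, ⟨_, .inr .cross_anti⟩,
      ⟨_, .inr .cross_diag⟩]
  · interval_cases i
    exacts [⟨_, .inl (.row_zero j ⟨hj2, hj⟩)⟩, ⟨_, .inl (.row_one j ⟨hj2, hj⟩)⟩,
      ⟨_, .inl (.row_two j ⟨hj2, hj⟩)⟩]
  · interval_cases j
    exacts [⟨_, .inr (.row_one i ⟨hi2, hi⟩)⟩, ⟨_, .inr (.row_two i ⟨hi2, hi⟩)⟩,
      ⟨_, .inr (.row_zero i ⟨hi2, hi⟩)⟩]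
  · obtain ⟨p, hp, rfl | rfl⟩ : ∃ p, (2 ≤ p ∧ p ≤ n) ∧ (i = 2 * p - 1 ∨ i = 2 * p) :=
      ⟨(i + 1) / 2, by omega, by omega⟩ <;>
    obtain ⟨q, hq, rfl | rfl⟩ : ∃ q, (2 ≤ q ∧ q ≤ n) ∧ (j = 2 * q - 1 ∨ j = 2 * q) :=
      ⟨(j + 1) / 2, by omega, by omega⟩
    exacts [⟨_, .inl (.block_diag p q hp hq)⟩, ⟨_, .inl (.block_anti p q hp hq)⟩,
      ⟨_, .inr (.block_anti p q hp hq)⟩, ⟨_, .inr (.block_diag p q hp hq)⟩]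

theorem isPairPartition_gridPartition (hn : 1 ≤ n) : IsPairPartition (gridPartition n) := by
  let val : Fin (2 * n + 1) × Fin (2 * n + 1) → ℕ × ℕ := fun x ↦ (x.1, x.2)
  have hval : Function.Injective val := Fin.val_injective.prodMap Fin.val_injective
  refine isPairPartition_eqvGen (fun x y h hxy ↦ h.ne (congrArg val hxy)) (fun x y z hy hz ↦ ?_)
    fun x ↦ ⟨?_, fun hx ↦ ?_⟩
  · exact hval ((GridPair.mate_eq_of_symmGen hy).symm.trans (GridPair.mate_eq_of_symmGen hz))
  · rintro ⟨y, h | h⟩ rfl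
    exacts [h.ne_zero.1 rfl, h.ne_zero.2 rfl]
  · obtain ⟨y, h⟩ := exists_symmGen_gridPair x.1.is_le x.2.is_le fun h ↦ hx (hval h)
    have hy : y.1 < 2 * n + 1 ∧ y.2 < 2 * n + 1 :=
      h.elim (fun h ↦ (h.lt hn).2) fun h ↦ (h.lt hn).1
    exact ⟨(⟨y.1, hy.1⟩, ⟨y.2, hy.2⟩), h⟩

theorem gridPartition_of_gridPair {x y : Fin (2 * n + 1) × Fin (2 * n + 1)}
    (h : GridPair n (x.1, x.2) (y.1, y.2)) : gridPartition n x y :=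
  .rel _ _ h

theorem rowConnected_gridPartition (hn : 1 ≤ n) : RowConnected (gridPartition n) := by
  refine rowConnected_of_forall_rel 0 fun i ↦ ?_
  rcases (by omega : i.val = 0 ∨ i.val = 1 ∨ i.val = 2 ∨ 3 ≤ i.val) with hi | hi | hi | hi
  · exact ⟨0, 0, by rw [Fin.val_eq_zero_iff.mp hi]⟩
  · exact ⟨⟨1, by omega⟩, 0, gridPartition_of_gridPair (by simpa [hi] using .corner_one)⟩
  · exact ⟨⟨2, by omega⟩, 0, gridPartition_of_gridPair (by simpa [hi] using .corner_two)⟩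
  · exact ⟨i, ⟨2, by omega⟩, gridPartition_of_gridPair (.row_zero i ⟨hi, i.is_le⟩)⟩

theorem columnConnected_gridPartition (hn : 1 ≤ n) : ColumnConnected (gridPartition n) := by
  refine columnConnected_of_forall_rel 0 fun j ↦ ?_
  rcases (by omega : j.val = 0 ∨ j.val = 1 ∨ j.val = 2 ∨ 3 ≤ j.val) with hj | hj | hj | hj
  · exact ⟨0, 0, by rw [Fin.val_eq_zero_iff.mp hj]⟩
  · exact ⟨⟨1, by omega⟩, 0,
      .symm _ _ (gridPartition_of_gridPair (by simpa [hj] using .corner_one))⟩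
  · exact ⟨⟨2, by omega⟩, 0,
      .symm _ _ (gridPartition_of_gridPair (by simpa [hj] using .corner_two))⟩
  · exact ⟨j, ⟨1, by omega⟩, .symm _ _ (gridPartition_of_gridPair (.row_one j ⟨hj, j.is_le⟩))⟩

end GridPartition

section Model

theorem act_gen {k : ℕ} (i : Fin k) : act k (gen i) = alpha :=
  lift_zpowersHom_gen (fun _ ↦ alpha) i

theorem inr_gen_mul_inl {k : ℕ} (i : Fin k) (v : C2 × C2) :
    (SemidirectProduct.inr (gen i) * SemidirectProduct.inl v : (C2 × C2) ⋊[act k] FreeProdZ k) =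
      SemidirectProduct.inl (alpha v) * SemidirectProduct.inr (gen i) := by
  rw [← act_gen i, SemidirectProduct.inl_aut, map_inv, inv_mul_cancel_right]

theorem orderOf_alpha : orderOf alpha = 3 := by
  refine orderOf_eq_prime (MulEquiv.ext ?_) fun h ↦ ?_
  · change ∀ v, alpha (alpha (alpha v)) = v
    decide
  · have hc := DFunLike.congr_fun h (1, c)
    revert hc
    decide

theorem c_mul_c : c * c = 1 := by decide

theorem orderOf_c : orderOf c = 2 :=
  orderOf_eq_prime (by decide) (by decide)

theorem eq_one_or_eq_c (x : C2) : x = 1 ∨ x = c := by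
  revert x
  decide

theorem c2_hom_ext {G : Type*} [Monoid G] {f g : C2 →* G} (h : f c = g c) : f = g := by
  ext x
  rcases eq_one_or_eq_c x with rfl | rfl
  exacts [(map_one f).trans (map_one g).symm, h]

theorem prod_hom_ext {M N P : Type*} [Monoid M] [Monoid N] [Monoid P] {f g : M × N →* P}
    (hl : f.comp (MonoidHom.inl M N) = g.comp (MonoidHom.inl M N))
    (hr : f.comp (MonoidHom.inr M N) = g.comp (MonoidHom.inr M N)) : f = g := by
  rw [← f.noncommCoprod_unique, ← g.noncommCoprod_unique]
  congr

theorem c2_prod_hom_ext {G : Type*} [Monoid G] {f g : C2 × C2 →* G}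
    (hl : f (c, 1) = g (c, 1)) (hr : f (1, c) = g (1, c)) : f = g :=
  prod_hom_ext (c2_hom_ext hl) (c2_hom_ext hr)

/-- The homomorphism from the cyclic group of order two given by an element of square one. -/
def c2Hom {G : Type*} [Group G] (g : G) (hg : g * g = 1) : C2 →* G where
  toFun x := if x = 1 then 1 else g
  map_one' := if_pos rfl
  map_mul' x y := by
    have hc : c ≠ 1 := by decide
    rcases eq_one_or_eq_c x with rfl | rfl <;> rcases eq_one_or_eq_c y with rfl | rfl <;>
      simp [hc, c_mul_c, hg]

@[simp]
theorem c2Hom_c {G : Type*} [Group G] (g : G) (hg : g * g = 1) : c2Hom g hg c = g :=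
  if_neg (t := 1) (show c ≠ 1 by decide)

theorem conj_comp_eq_iff {M G : Type*} [Monoid M] [Group G] {g : G} {f : M →* G} :
    (MulAut.conj g).toMonoidHom.comp f = f ↔ ∀ x, Commute g (f x) := by
  simp [MonoidHom.ext_iff, commute_iff_eq, mul_inv_eq_iff_eq_mul]

theorem commute_c2Hom {G : Type*} [Group G] {g x : G} (hg : g * g = 1) (h : Commute x g) :
    ∀ u, Commute x (c2Hom g hg u) :=
  conj_comp_eq_iff.mp <| c2_hom_ext <| by
    simpa [mul_inv_eq_iff_eq_mul, commute_iff_eq] using h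

/-- The conclusion is the compatibility condition of `SemidirectProduct.lift`. -/
theorem comp_eq_conj_comp_of_closure_eq_top {N H G : Type*} [Group N] [Group H] [Group G]
    {φ : H →* MulAut N} {fn : N →* G} {fg : H →* G} {S : Set H} (hS : Subgroup.closure S = ⊤)
    (h : ∀ g ∈ S, fn.comp (φ g).toMonoidHom = (MulAut.conj (fg g)).toMonoidHom.comp fn) (g : H) :
    fn.comp (φ g).toMonoidHom = (MulAut.conj (fg g)).toMonoidHom.comp fn := by
  have hg : g ∈ Subgroup.closure S := hS ▸ Subgroup.mem_top g
  simp only [MonoidHom.ext_iff, MonoidHom.comp_apply, MulEquiv.toMonoidHom_eq_coe,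
    MonoidHom.coe_coe, MulAut.conj_apply] at h ⊢
  induction hg using Subgroup.closure_induction with
  | mem g hg => exact h g hg
  | one => simp
  | mul g g' _ _ ih ih' => simp [ih, ih', mul_assoc]
  | inv g _ ih =>
    intro v
    have hv := ih ((φ g)⁻¹ v)
    rw [MulAut.apply_inv_self] at hv
    simp [hv, mul_assoc]

end Model

/-- A family of elements of a group `G` satisfying the relations between the standard generators of
`Model k`: homomorphisms from `Model k` to `G` amount to such families. -/
@[ext]
structure ModelFamily (k : ℕ) (G : Type*) [Group G] where
  t : G
  s : G
  a : G
  x : Fin k → G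
  t_mul_t : t * t = 1
  s_mul_s : s * s = 1
  a_mul_a : a * a = 1
  commute_s_a : Commute s a
  commute_t_s : Commute t s
  commute_t_a : Commute t a
  commute_t_x : ∀ i, Commute t (x i)
  x_mul_a : ∀ i, x i * a = s * x i
  x_mul_s : ∀ i, x i * s = s * a * x i

namespace ModelFamily

variable {k : ℕ} {G H : Type*} [Group G] [Group H]

/-- The image of a family under a homomorphism. -/
@[simps]
def map (M : ModelFamily k G) (f : G →* H) : ModelFamily k H where
  t := f M.t
  s := f M.s
  a := f M.a
  x i := f (M.x i)
  t_mul_t := by rw [← map_mul, M.t_mul_t, map_one]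
  s_mul_s := by rw [← map_mul, M.s_mul_s, map_one]
  a_mul_a := by rw [← map_mul, M.a_mul_a, map_one]
  commute_s_a := M.commute_s_a.map f
  commute_t_s := M.commute_t_s.map f
  commute_t_a := M.commute_t_a.map f
  commute_t_x i := (M.commute_t_x i).map f
  x_mul_a i := by rw [← map_mul, M.x_mul_a, map_mul]
  x_mul_s i := by rw [← map_mul, M.x_mul_s, map_mul, map_mul]

/-- The standard generators of the model group. -/
@[simps]
def standard (k : ℕ) : ModelFamily k (Model k) where
  t := (c, 1)
  s := (1, SemidirectProduct.inl (c, 1))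
  a := (1, SemidirectProduct.inl (1, c))
  x i := (1, SemidirectProduct.inr (gen i))
  t_mul_t := by simp [c_mul_c]
  s_mul_s := Prod.ext rfl (by simp [← map_mul, c_mul_c, ← Prod.one_eq_mk])
  a_mul_a := Prod.ext rfl (by simp [← map_mul, c_mul_c, ← Prod.one_eq_mk])
  commute_s_a := by simp [commute_iff_eq, ← map_mul]
  commute_t_s := by simp [commute_iff_eq]
  commute_t_a := by simp [commute_iff_eq]
  commute_t_x i := by simp [commute_iff_eq]
  x_mul_a i := by
    rw [Prod.mk_mul_mk, inr_gen_mul_inl]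
    rfl
  x_mul_s i := by
    rw [Prod.mk_mul_mk, inr_gen_mul_inl, Prod.mk_mul_mk, Prod.mk_mul_mk, ← map_mul]
    rfl

theorem model_hom_ext {f g : Model k →* G} (h : (standard k).map f = (standard k).map g) :
    f = g := by
  obtain ⟨ht, hs, ha, hx⟩ := ModelFamily.mk.inj h
  exact prod_hom_ext (c2_hom_ext ht)
    (SemidirectProduct.hom_ext (c2_prod_hom_ext hs ha) (freeProdZ_hom_ext (congrFun hx)))

variable (M : ModelFamily k G)

/-- The homomorphism from the Klein four-group given by `s` and `a`. -/
def kleinHom : C2 × C2 →* G :=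
  (c2Hom M.s M.s_mul_s).noncommCoprod (c2Hom M.a M.a_mul_a) fun u v ↦
    commute_c2Hom _ (commute_c2Hom _ M.commute_s_a.symm u).symm v

/-- The homomorphism from the free product given by the elements `x i`. -/
def freeHom : FreeProdZ k →* G :=
  Monoid.CoprodI.lift fun i ↦ zpowersHom G (M.x i)

@[simp]
theorem freeHom_gen (i : Fin k) : M.freeHom (gen i) = M.x i :=
  lift_zpowersHom_gen M.x i

theorem kleinHom_comp_act (g : FreeProdZ k) :
    M.kleinHom.comp (act k g).toMonoidHom =
      (MulAut.conj (M.freeHom g)).toMonoidHom.comp M.kleinHom := by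
  refine comp_eq_conj_comp_of_closure_eq_top (closure_range_gen k) ?_ g
  rintro _ ⟨i, rfl⟩
  apply c2_prod_hom_ext <;>
    simp [act_gen, alpha, kleinHom, M.x_mul_a, M.x_mul_s]

/-- The homomorphism from the semidirect product given by `s`, `a` and the elements `x i`. -/
def semidirectHom : (C2 × C2) ⋊[act k] FreeProdZ k →* G :=
  SemidirectProduct.lift M.kleinHom M.freeHom M.kleinHom_comp_act

theorem commute_t_semidirectHom (v : (C2 × C2) ⋊[act k] FreeProdZ k) :
    Commute M.t (M.semidirectHom v) := by
  refine conj_comp_eq_iff.mp (SemidirectProduct.hom_ext (c2_prod_hom_ext ?_ ?_)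
    (freeProdZ_hom_ext fun i ↦ ?_)) v
  · simpa [semidirectHom, kleinHom, mul_inv_eq_iff_eq_mul] using M.commute_t_s.eq
  · simpa [semidirectHom, kleinHom, mul_inv_eq_iff_eq_mul] using M.commute_t_a.eq
  · simpa [semidirectHom, mul_inv_eq_iff_eq_mul] using (M.commute_t_x i).eq

/-- The homomorphism from the model group given by a family. -/
def lift : Model k →* G :=
  (c2Hom M.t M.t_mul_t).noncommCoprod M.semidirectHom fun u v ↦
    (commute_c2Hom _ (M.commute_t_semidirectHom v).symm u).symm

theorem standard_map_lift : (standard k).map M.lift = M := by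
  ext <;> simp [lift, semidirectHom, kleinHom]

/-- The elements that the family assigns to the generators of `Γ_π`: `elem 1 i` is the image of `aᵢ`
and `elem a j` is the image of `bⱼ`. The exponent of `t` matters only modulo `2`, and the value is
`1` for indices beyond `2k + 2`. -/
def elem (u : G) : ℕ → G
  | 0 => 1
  | 1 => M.a
  | 2 => M.a * M.s
  | j + 3 => if h : j / 2 < k then u * (M.x ⟨j / 2, h⟩ * M.t ^ j) else 1

theorem map_elem (f : G →* H) (u : G) (j : ℕ) : f (M.elem u j) = (M.map f).elem (f u) j := by
  match j with
  | 0 => exact map_one f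
  | 1 => rfl
  | 2 => exact map_mul f _ _
  | j + 3 => by_cases h : j / 2 < k <;> simp [elem, h]

theorem elem_of_lt (u : G) {j : ℕ} (h : j / 2 < k) :
    M.elem u (j + 3) = u * (M.x ⟨j / 2, h⟩ * M.t ^ j) :=
  dif_pos h

end ModelFamily

section GridFamily

/-- Elements `A i` and `B j` of a group `G` satisfying the relations of `Γ_π` for the grid
partition: homomorphisms from `Γ_π` to `G` amount to such families. The indices `i` and `j` run over
all natural numbers, but only the values up to `2n` matter. -/
structure GridFamily (n : ℕ) (G : Type*) [Group G] where
  A : ℕ → G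
  B : ℕ → G
  A_zero : A 0 = 1
  B_zero : B 0 = 1
  rel : ∀ {x y}, GridPair n x y → A x.1 * B x.2 = A y.1 * B y.2

namespace ModelFamily

variable {k : ℕ} {G : Type*} [Group G] (M : ModelFamily k G)

theorem exists_elem_eq {j : ℕ} (hj : 3 ≤ j ∧ j ≤ 2 * (k + 1)) :
    ∃ i r, ∀ u, M.elem u j = u * (M.x i * M.t ^ r) := by
  obtain ⟨j, rfl⟩ := Nat.exists_eq_add_of_le' hj.1
  exact ⟨⟨j / 2, by omega⟩, j, fun u ↦ M.elem_of_lt u _⟩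

theorem elem_eq_mul (u : G) {j : ℕ} (hj : 3 ≤ j ∧ j ≤ 2 * (k + 1)) :
    M.elem u j = u * M.elem 1 j := by
  obtain ⟨i, r, h⟩ := M.exists_elem_eq hj
  rw [h, h, one_mul]

theorem elem_one_mul_a {j : ℕ} (hj : 3 ≤ j ∧ j ≤ 2 * (k + 1)) :
    M.elem 1 j * M.a = M.s * M.elem 1 j := by
  obtain ⟨i, r, h⟩ := M.exists_elem_eq hj
  rw [h, one_mul, mul_assoc, (M.commute_t_a.pow_left r).eq, ← mul_assoc, M.x_mul_a, mul_assoc]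

theorem elem_one_mul_s {j : ℕ} (hj : 3 ≤ j ∧ j ≤ 2 * (k + 1)) :
    M.elem 1 j * M.s = M.s * M.a * M.elem 1 j := by
  obtain ⟨i, r, h⟩ := M.exists_elem_eq hj
  rw [h, one_mul, mul_assoc, (M.commute_t_s.pow_left r).eq, ← mul_assoc, M.x_mul_s, mul_assoc]

theorem commute_t_elem {u : G} (hu : Commute M.t u) {j : ℕ} (hj : 3 ≤ j ∧ j ≤ 2 * (k + 1)) :
    Commute M.t (M.elem u j) := by
  obtain ⟨i, r, h⟩ := M.exists_elem_eq hj
  rw [h]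
  exact hu.mul_right ((M.commute_t_x i).mul_right (Commute.self_pow _ _))

theorem t_pow_two_mul (i : ℕ) : M.t ^ (2 * i) = 1 := by
  rw [pow_mul, pow_two, M.t_mul_t, one_pow]

theorem elem_two_mul_add_three (u : G) (i : Fin k) : M.elem u (2 * i + 3) = u * M.x i := by
  have hi : 2 * i.val / 2 = i := by omega
  rw [M.elem_of_lt u (by omega), t_pow_two_mul, mul_one]
  simp only [hi]

theorem elem_two_mul_add_four (u : G) (i : Fin k) : M.elem u (2 * i + 4) = u * M.x i * M.t := by
  have hi : (2 * i.val + 1) / 2 = i := by omega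
  rw [M.elem_of_lt u (by omega), pow_succ, t_pow_two_mul, one_mul, mul_assoc]
  simp only [hi]

theorem elem_one_inv_mul_elem_one (i : Fin k) :
    (M.elem 1 (2 * i + 3))⁻¹ * M.elem 1 (2 * i + 4) = M.t := by
  rw [elem_two_mul_add_three, elem_two_mul_add_four, inv_mul_cancel_left]

theorem elem_two_mul (u : G) {p : ℕ} (hp : 2 ≤ p ∧ p ≤ k + 1) :
    M.elem u (2 * p) = M.elem u (2 * p - 1) * M.t := by
  obtain ⟨i, rfl⟩ : ∃ i : Fin k, p = i + 2 := ⟨⟨p - 2, by omega⟩, by simp; omega⟩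
  exact (M.elem_two_mul_add_four u i).trans (by rw [← M.elem_two_mul_add_three u i]; rfl)

/-- The grid family with `aᵢ = elem 1 i` and `bⱼ = elem a j`. -/
@[simps]
def toGridFamily : GridFamily (k + 1) G where
  A := M.elem 1
  B := M.elem M.a
  A_zero := rfl
  B_zero := rfl
  rel {x y} h := by
    cases h with
    | corner_one => exact (one_mul _).trans (mul_one _).symm
    | corner_two => exact (one_mul _).trans (mul_one _).symm
    | cross_diag =>
      change M.a * M.a = M.a * M.s * (M.a * M.s)
      rw [M.commute_s_a.mul_mul_mul_comm, M.s_mul_s, mul_one]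
    | cross_anti =>
      change M.a * (M.a * M.s) = M.a * M.s * M.a
      rw [mul_assoc, M.commute_s_a.eq]
    | block_diag p q hp hq =>
      have hc : Commute M.t (M.elem M.a (2 * q - 1)) :=
        M.commute_t_elem M.commute_t_a (by omega)
      change M.elem 1 (2 * p - 1) * M.elem M.a (2 * q - 1) = M.elem 1 (2 * p) * M.elem M.a (2 * q)
      rw [M.elem_two_mul _ hp, M.elem_two_mul _ hq, ← hc.eq, mul_assoc, ← mul_assoc M.t M.t,
        M.t_mul_t, one_mul]
    | block_anti p q hp hq =>
      have hc : Commute M.t (M.elem M.a (2 * q - 1)) :=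
        M.commute_t_elem M.commute_t_a (by omega)
      change M.elem 1 (2 * p - 1) * M.elem M.a (2 * q) = M.elem 1 (2 * p) * M.elem M.a (2 * q - 1)
      rw [M.elem_two_mul _ hp, M.elem_two_mul _ hq, ← hc.eq, mul_assoc]
    | row_zero j hj =>
      change 1 * M.elem M.a j = M.elem 1 j * (M.a * M.s)
      rw [M.elem_eq_mul M.a hj, one_mul, ← mul_assoc, M.elem_one_mul_a hj, mul_assoc,
        M.elem_one_mul_s hj, ← mul_assoc, ← mul_assoc, M.s_mul_s, one_mul]
    | row_one j hj =>
      change M.a * M.elem M.a j = M.elem 1 j * 1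
      rw [M.elem_eq_mul M.a hj, ← mul_assoc, M.a_mul_a, one_mul, mul_one]
    | row_two j hj =>
      change M.a * M.s * M.elem M.a j = M.elem 1 j * M.a
      rw [M.elem_eq_mul M.a hj, M.elem_one_mul_a hj, ← M.commute_s_a.eq, mul_assoc,
        ← mul_assoc M.a, M.a_mul_a, one_mul]

end ModelFamily

namespace GridFamily

variable {n : ℕ} {G : Type*} [Group G] (F : GridFamily n G)

/-- The element `s = a₁⁻¹a₂`. -/
def s : G := (F.A 1)⁻¹ * F.A 2

/-- The element `t = a₃⁻¹a₄`. -/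
def t : G := (F.A 3)⁻¹ * F.A 4

theorem A_one_mul_s : F.A 1 * F.s = F.A 2 :=
  mul_inv_cancel_left _ _

theorem B_one : F.B 1 = F.A 1 := by
  simpa [F.A_zero, F.B_zero] using F.rel .corner_one

theorem B_two : F.B 2 = F.A 2 := by
  simpa [F.A_zero, F.B_zero] using F.rel .corner_two

theorem commute_s_A_one : Commute F.s (F.A 1) := by
  have h : F.A 1 * F.A 2 = F.A 2 * F.A 1 := by simpa [F.B_one, F.B_two] using F.rel .cross_anti
  exact (Commute.refl (F.A 1)).inv_left.mul_left (Commute.symm h)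

theorem s_mul_s : F.s * F.s = 1 := by
  have h : F.A 1 * F.A 1 = F.A 2 * F.A 2 := by simpa [F.B_one, F.B_two] using F.rel .cross_diag
  rw [← F.A_one_mul_s, mul_assoc, mul_right_inj, ← mul_assoc, F.commute_s_A_one.eq, mul_assoc] at h
  exact mul_eq_left.mp h.symm

section Rows

variable {j : ℕ}

theorem A_one_mul_B (hj : 3 ≤ j ∧ j ≤ 2 * n) : F.A 1 * F.B j = F.A j := by
  simpa [F.B_zero] using F.rel (.row_one j hj)

theorem A_mul_A_two (hj : 3 ≤ j ∧ j ≤ 2 * n) : F.A j * F.A 2 = F.B j := by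
  simpa [F.A_zero, F.B_two] using (F.rel (.row_zero j hj)).symm

theorem A_mul_A_one (hj : 3 ≤ j ∧ j ≤ 2 * n) : F.A j * F.A 1 = F.s * F.A j := by
  have h : F.A 2 * F.B j = F.A j * F.A 1 := by simpa [F.B_one] using F.rel (.row_two j hj)
  rw [← h, ← F.A_one_mul_s, ← F.commute_s_A_one.eq, mul_assoc, F.A_one_mul_B hj]

theorem A_one_mul_A_one (hn : 2 ≤ n) : F.A 1 * F.A 1 = 1 := by
  have h3 := F.A_mul_A_one (j := 3) ⟨le_rfl, by omega⟩
  refine mul_eq_left (a := F.A 3).mp ?_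
  rw [← mul_assoc, h3, mul_assoc, h3, ← mul_assoc, F.s_mul_s, one_mul]

theorem A_one_mul_A (hn : 2 ≤ n) (hj : 3 ≤ j ∧ j ≤ 2 * n) : F.A 1 * F.A j = F.B j := by
  rw [← F.A_one_mul_B hj, ← mul_assoc, F.A_one_mul_A_one hn, one_mul]

theorem A_mul_s (hn : 2 ≤ n) (hj : 3 ≤ j ∧ j ≤ 2 * n) :
    F.A j * F.s = F.s * F.A 1 * F.A j := by
  have h : F.s * (F.A j * F.s) = F.A 1 * F.A j := by
    rw [← mul_assoc, ← F.A_mul_A_one hj, mul_assoc, F.A_one_mul_s, F.A_mul_A_two hj,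
      F.A_one_mul_A hn hj]
  rw [mul_assoc, ← h, ← mul_assoc F.s F.s, F.s_mul_s, one_mul]

end Rows

theorem commute_A_inv_mul_A_A_one {i j : ℕ} (hi : 3 ≤ i ∧ i ≤ 2 * n) (hj : 3 ≤ j ∧ j ≤ 2 * n) :
    Commute ((F.A i)⁻¹ * F.A j) (F.A 1) :=
  have h : SemiconjBy (F.A i) (F.A 1) F.s := F.A_mul_A_one hi
  h.inv_symm_left.mul_left (F.A_mul_A_one hj)

theorem commute_t_A_one (hn : 2 ≤ n) : Commute F.t (F.A 1) :=
  F.commute_A_inv_mul_A_A_one (by omega) (by omega)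

theorem commute_t_s (hn : 2 ≤ n) : Commute F.t F.s :=
  have h3 : SemiconjBy (F.A 3) F.s (F.s * F.A 1) := F.A_mul_s hn (by omega)
  h3.inv_symm_left.mul_left (F.A_mul_s hn (by omega))

/-- The relations of a block say that `aᵢ⁻¹aᵢ₊₁`, with `i = 2p - 1`, is equal both to
`bⱼbⱼ₊₁⁻¹` and to its inverse, with `j = 2q - 1`; as it commutes with `a₁`, one can replace `b` by
`a` here. -/
theorem A_inv_mul_A_mul_A (hn : 2 ≤ n) {p q : ℕ} (hp : 2 ≤ p ∧ p ≤ n) (hq : 2 ≤ q ∧ q ≤ n) :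
    (F.A (2 * p - 1))⁻¹ * F.A (2 * p) * F.A (2 * q - 1) = F.A (2 * q) ∧
      (F.A (2 * p - 1))⁻¹ * F.A (2 * p) * F.A (2 * q) = F.A (2 * q - 1) := by
  have hd : Commute ((F.A (2 * p - 1))⁻¹ * F.A (2 * p)) (F.A 1) :=
    F.commute_A_inv_mul_A_A_one (by omega) (by omega)
  have hodd := F.A_one_mul_A hn (j := 2 * q - 1) (by omega)
  have heven := F.A_one_mul_A hn (j := 2 * q) (by omega)
  have hdiag := F.rel (.block_diag p q hp hq)
  have hanti := F.rel (.block_anti p q hp hq)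
  constructor <;> refine mul_left_cancel (a := F.A 1) ?_
  · rw [← mul_assoc, ← hd.eq, mul_assoc, hodd, heven, mul_assoc, inv_mul_eq_iff_eq_mul]
    exact hanti.symm
  · rw [← mul_assoc, ← hd.eq, mul_assoc, hodd, heven, mul_assoc, inv_mul_eq_iff_eq_mul]
    exact hdiag.symm

theorem t_mul_t (hn : 2 ≤ n) : F.t * F.t = 1 := by
  obtain ⟨h3, h4⟩ := F.A_inv_mul_A_mul_A hn (p := 2) (q := 2) ⟨le_rfl, hn⟩ ⟨le_rfl, hn⟩
  change F.t * F.A 3 = F.A 4 at h3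
  change F.t * F.A 4 = F.A 3 at h4
  rw [← h3, ← mul_assoc] at h4
  exact mul_eq_right.mp h4

theorem t_mul_A {q : ℕ} (hq : 2 ≤ q ∧ q ≤ n) : F.t * F.A (2 * q - 1) = F.A (2 * q) :=
  have hn := hq.1.trans hq.2
  (F.A_inv_mul_A_mul_A hn (p := 2) ⟨le_rfl, hn⟩ hq).1

theorem A_mul_t {q : ℕ} (hq : 2 ≤ q ∧ q ≤ n) : F.A (2 * q - 1) * F.t = F.A (2 * q) := by
  have hn := hq.1.trans hq.2
  have h : (F.A (2 * q - 1))⁻¹ * F.A (2 * q) * F.A 3 = F.t * F.A 3 :=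
    (F.A_inv_mul_A_mul_A hn (q := 2) hq ⟨le_rfl, hn⟩).1.trans
      (F.t_mul_A (q := 2) ⟨le_rfl, hn⟩).symm
  rw [← mul_right_cancel h, mul_inv_cancel_left]

variable {k : ℕ} (F : GridFamily (k + 1) G)

/-- The generators of the model group, as expressed by the generators of `Γ_π`. -/
@[simps]
def toModelFamily (hk : 1 ≤ k) : ModelFamily k G where
  t := F.t
  s := F.s
  a := F.A 1
  x i := F.A (2 * i + 3)
  t_mul_t := F.t_mul_t (by omega)
  s_mul_s := F.s_mul_s
  a_mul_a := F.A_one_mul_A_one (by omega)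
  commute_s_a := F.commute_s_A_one
  commute_t_s := F.commute_t_s (by omega)
  commute_t_a := F.commute_t_A_one (by omega)
  commute_t_x i := by
    have hi : 2 ≤ i.val + 2 ∧ i.val + 2 ≤ k + 1 := by omega
    exact (F.t_mul_A hi).trans (F.A_mul_t hi).symm
  x_mul_a i := F.A_mul_A_one (by omega)
  x_mul_s i := F.A_mul_s (by omega) (by omega)

theorem elem_one_toModelFamily (hk : 1 ≤ k) {j : ℕ} (hj : j ≤ 2 * (k + 1)) :
    (F.toModelFamily hk).elem 1 j = F.A j := by
  rcases (by omega : j = 0 ∨ j = 1 ∨ j = 2 ∨ 3 ≤ j) with rfl | rfl | rfl | h3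
  · exact F.A_zero.symm
  · rfl
  · exact F.A_one_mul_s
  obtain ⟨i, rfl | rfl⟩ : ∃ i, j = 2 * i + 3 ∨ j = 2 * i + 4 := ⟨(j - 3) / 2, by omega⟩
  · simpa using (F.toModelFamily hk).elem_two_mul_add_three 1 ⟨i, by omega⟩
  · have hi : 2 ≤ i + 2 ∧ i + 2 ≤ k + 1 := by omega
    rw [(F.toModelFamily hk).elem_two_mul_add_four 1 ⟨i, by omega⟩, one_mul]
    exact F.A_mul_t hi

theorem elem_A_one_toModelFamily (hk : 1 ≤ k) {j : ℕ} (hj : j ≤ 2 * (k + 1)) :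
    (F.toModelFamily hk).elem (F.A 1) j = F.B j := by
  rcases (by omega : j = 0 ∨ j = 1 ∨ j = 2 ∨ 3 ≤ j) with rfl | rfl | rfl | h3
  · exact F.B_zero.symm
  · exact F.B_one.symm
  · exact F.A_one_mul_s.trans F.B_two.symm
  · rw [(F.toModelFamily hk).elem_eq_mul _ ⟨h3, hj⟩, F.elem_one_toModelFamily hk hj,
      F.A_one_mul_A (by omega) ⟨h3, hj⟩]

end GridFamily

end GridFamily

section Isomorphism

theorem a_zero {m n : ℕ} [NeZero m] {π : Setoid (Fin m × Fin n)} : a π 0 = 1 :=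
  PresentedGroup.one_of_mem (rels := relators π) (.inl ⟨0, rfl, rfl⟩)

theorem b_zero {m n : ℕ} [NeZero n] {π : Setoid (Fin m × Fin n)} : b π 0 = 1 :=
  PresentedGroup.one_of_mem (rels := relators π) (.inr (.inl ⟨0, rfl, rfl⟩))

theorem a_mul_b_eq {m n : ℕ} {π : Setoid (Fin m × Fin n)} {x y : Fin m × Fin n} (h : π x y) :
    a π x.1 * b π x.2 = a π y.1 * b π y.2 := by
  have hrel := PresentedGroup.one_of_mem (rels := relators π) (.inr (.inr ⟨x, y, h, rfl⟩))
  rwa [map_mul, map_inv, mul_inv_eq_one, map_mul, map_mul] at hrel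

theorem gam_hom_ext {m n : ℕ} {π : Setoid (Fin m × Fin n)} {G : Type*} [Group G]
    {f g : Gam π →* G} (ha : ∀ i, f (a π i) = g (a π i)) (hb : ∀ j, f (b π j) = g (b π j)) :
    f = g :=
  PresentedGroup.ext fun x ↦ Sum.casesOn x ha hb

namespace GridFamily

/-- The family of the generators of `Γ_π`. -/
def universal {n : ℕ} (hn : 1 ≤ n) : GridFamily n (Gam (gridPartition n)) where
  A i := a (gridPartition n) (Fin.ofNat (2 * n + 1) i)
  B j := b (gridPartition n) (Fin.ofNat (2 * n + 1) j)
  A_zero := a_zero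
  B_zero := b_zero
  rel {x y} h := by
    obtain ⟨⟨hx1, hx2⟩, hy1, hy2⟩ := h.lt hn
    refine a_mul_b_eq (x := (_, _)) (y := (_, _)) (gridPartition_of_gridPair ?_)
    simpa [Nat.mod_eq_of_lt, hx1, hx2, hy1, hy2] using h

theorem universal_A {n : ℕ} (hn : 1 ≤ n) (i : Fin (2 * n + 1)) :
    (universal hn).A i = a (gridPartition n) i := by
  simp [universal]

theorem universal_B {n : ℕ} (hn : 1 ≤ n) (j : Fin (2 * n + 1)) :
    (universal hn).B j = b (gridPartition n) j := by
  simp [universal]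

variable {n : ℕ} {G : Type*} [Group G] (F : GridFamily n G)

theorem mul_eq_of_gridPartition {x y : Fin (2 * n + 1) × Fin (2 * n + 1)}
    (h : gridPartition n x y) : F.A x.1 * F.B x.2 = F.A y.1 * F.B y.2 := by
  induction h with
  | rel x y h => exact F.rel h
  | refl x => rfl
  | symm x y _ ih => exact ih.symm
  | trans x y z _ _ ih ih' => exact ih.trans ih'

/-- The homomorphism from `Γ_π` given by a family. -/
def lift : Gam (gridPartition n) →* G :=
  PresentedGroup.toGroup (rels := relators (gridPartition n))
    (f := Sum.elim (fun i : Fin (2 * n + 1) ↦ F.A i) fun j : Fin (2 * n + 1) ↦ F.B j) <| by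
    rintro _ (⟨i, hi, rfl⟩ | ⟨j, hj, rfl⟩ | ⟨x, y, h, rfl⟩)
    · simp [hi, F.A_zero]
    · simp [hj, F.B_zero]
    · simp only [map_mul, map_inv, FreeGroup.lift_apply_of, Sum.elim_inl, Sum.elim_inr,
        mul_inv_eq_one]
      exact F.mul_eq_of_gridPartition h

@[simp]
theorem lift_a (i : Fin (2 * n + 1)) : F.lift (a (gridPartition n) i) = F.A i :=
  PresentedGroup.toGroup.of _

@[simp]
theorem lift_b (j : Fin (2 * n + 1)) : F.lift (b (gridPartition n) j) = F.B j :=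
  PresentedGroup.toGroup.of _

end GridFamily

variable {k : ℕ}

/-- The homomorphism from `Γ_π` to the model group. -/
def gamToModel (k : ℕ) : Gam (gridPartition (k + 1)) →* Model k :=
  (ModelFamily.standard k).toGridFamily.lift

/-- The homomorphism from the model group to `Γ_π`. -/
def modelToGam (hk : 1 ≤ k) : Model k →* Gam (gridPartition (k + 1)) :=
  ((GridFamily.universal (by omega)).toModelFamily hk).lift

theorem gamToModel_a (i : Fin (2 * (k + 1) + 1)) :
    gamToModel k (a (gridPartition (k + 1)) i) = (ModelFamily.standard k).elem 1 i :=
  GridFamily.lift_a _ i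

theorem gamToModel_b (j : Fin (2 * (k + 1) + 1)) :
    gamToModel k (b (gridPartition (k + 1)) j) =
      (ModelFamily.standard k).elem (ModelFamily.standard k).a j :=
  GridFamily.lift_b _ j

theorem standard_map_modelToGam (hk : 1 ≤ k) :
    (ModelFamily.standard k).map (modelToGam hk) =
      (GridFamily.universal (by omega)).toModelFamily hk :=
  ModelFamily.standard_map_lift _

theorem modelToGam_comp_gamToModel (hk : 1 ≤ k) :
    (modelToGam hk).comp (gamToModel k) = MonoidHom.id _ := by
  have hmap := standard_map_modelToGam hk
  have ha : modelToGam hk (ModelFamily.standard k).a = (GridFamily.universal (by omega)).A 1 :=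
    congrArg ModelFamily.a hmap
  refine gam_hom_ext (fun i ↦ ?_) fun j ↦ ?_
  · rw [MonoidHom.comp_apply, gamToModel_a, ModelFamily.map_elem, hmap, map_one,
      GridFamily.elem_one_toModelFamily _ hk i.is_le, GridFamily.universal_A, MonoidHom.id_apply]
  · rw [MonoidHom.comp_apply, gamToModel_b, ModelFamily.map_elem, hmap, ha,
      GridFamily.elem_A_one_toModelFamily _ hk j.is_le, GridFamily.universal_B, MonoidHom.id_apply]

theorem toModelFamily_universal_map_gamToModel (hk : 1 ≤ k) :
    ((GridFamily.universal (by omega)).toModelFamily hk).map (gamToModel k) =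
      ModelFamily.standard k := by
  have hA : ∀ i < 2 * (k + 1) + 1, gamToModel k ((GridFamily.universal (by omega)).A i) =
      (ModelFamily.standard k).elem 1 i := fun i hi ↦ by
    rw [GridFamily.universal_A _ ⟨i, hi⟩, gamToModel_a]
  refine ModelFamily.ext ?_ ?_ ?_ (funext fun i ↦ ?_)
  · rw [ModelFamily.map_t, GridFamily.toModelFamily_t, GridFamily.t, map_mul, map_inv,
      hA _ (by omega), hA _ (by omega)]
    exact (ModelFamily.standard k).elem_one_inv_mul_elem_one ⟨0, hk⟩
  · rw [ModelFamily.map_s, GridFamily.toModelFamily_s, GridFamily.s, map_mul, map_inv,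
      hA _ (by omega), hA _ (by omega)]
    exact inv_mul_cancel_left _ _
  · exact hA 1 (by omega)
  · rw [ModelFamily.map_x, GridFamily.toModelFamily_x, hA _ (by omega),
      ModelFamily.elem_two_mul_add_three, one_mul]

theorem gamToModel_comp_modelToGam (hk : 1 ≤ k) :
    (gamToModel k).comp (modelToGam hk) = MonoidHom.id _ :=
  ModelFamily.model_hom_ext <|
    (congrArg (ModelFamily.map · (gamToModel k)) (standard_map_modelToGam hk)).trans
      (toModelFamily_universal_map_gamToModel hk)

/-- The isomorphism between `Γ_π` and the model group: both groups are universal for the same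
families of elements. -/
def gamEquivModel (hk : 1 ≤ k) : Gam (gridPartition (k + 1)) ≃* Model k :=
  (gamToModel k).toMulEquiv (modelToGam hk) (modelToGam_comp_gamToModel hk)
    (gamToModel_comp_modelToGam hk)

theorem gamEquivModel_a (hk : 1 ≤ k) (i : Fin (2 * (k + 1) + 1)) :
    gamEquivModel hk (a (gridPartition (k + 1)) i) = (ModelFamily.standard k).elem 1 i :=
  gamToModel_a i

theorem gamEquivModel_b (hk : 1 ≤ k) (j : Fin (2 * (k + 1) + 1)) :
    gamEquivModel hk (b (gridPartition (k + 1)) j) =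
      (ModelFamily.standard k).elem (ModelFamily.standard k).a j :=
  gamToModel_b j

end Isomorphism

section Nondegeneracy

variable {k : ℕ}

theorem elem_standard_add_three (v : C2 × C2) {j : ℕ} (hj : j / 2 < k) :
    (ModelFamily.standard k).elem (1, SemidirectProduct.inl v) (j + 3) =
      (c ^ j, SemidirectProduct.inl v * SemidirectProduct.inr (gen ⟨j / 2, hj⟩)) := by
  simp [ModelFamily.elem_of_lt _ _ hj]

theorem elem_standard_of_le_two (u : Model k) {i : ℕ} (hi : i ≤ 2) :
    ∃ v, (ModelFamily.standard k).elem u i = (1, SemidirectProduct.inl v) := by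
  interval_cases i
  exacts [⟨1, Prod.ext rfl (map_one _).symm⟩, ⟨(1, c), rfl⟩,
    ⟨(c, c), by simp [ModelFamily.elem, ← map_mul]⟩]

theorem elem_standard_injOn_Iic_two (u : Model k) :
    Set.InjOn ((ModelFamily.standard k).elem u) (Set.Iic 2) := by
  intro i hi j hj h
  rw [Set.mem_Iic] at hi hj
  have hc : c ≠ 1 := by decide
  interval_cases i <;> interval_cases j <;>
    simp_all [ModelFamily.elem, Prod.ext_iff, SemidirectProduct.ext_iff]

theorem elem_standard_injOn (v : C2 × C2) :
    Set.InjOn ((ModelFamily.standard k).elem (1, SemidirectProduct.inl v))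
      (Set.Iic (2 * (k + 1))) := by
  have hne : ∀ i ≤ 2, ∀ j, j + 3 ≤ 2 * (k + 1) →
      (ModelFamily.standard k).elem (1, SemidirectProduct.inl v) i ≠
        (ModelFamily.standard k).elem (1, SemidirectProduct.inl v) (j + 3) := by
    intro i hi j hj h
    obtain ⟨w, hw⟩ := elem_standard_of_le_two (1, SemidirectProduct.inl v) hi
    rw [hw, elem_standard_add_three v (by omega)] at h
    exact gen_ne_one _ (by simpa using (congrArg (fun z : Model k ↦ z.2.right) h).symm)
  intro i hi j hj h
  rw [Set.mem_Iic] at hi hj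
  rcases le_or_gt i 2 with hi2 | hi2 <;> rcases le_or_gt j 2 with hj2 | hj2
  · exact elem_standard_injOn_Iic_two _ hi2 hj2 h
  · obtain ⟨j, rfl⟩ := Nat.exists_eq_add_of_le' (show 3 ≤ j from hj2)
    exact absurd h (hne i hi2 j hj)
  · obtain ⟨i, rfl⟩ := Nat.exists_eq_add_of_le' (show 3 ≤ i from hi2)
    exact absurd h.symm (hne j hj2 i hi)
  · obtain ⟨i, rfl⟩ := Nat.exists_eq_add_of_le' (show 3 ≤ i from hi2)
    obtain ⟨j, rfl⟩ := Nat.exists_eq_add_of_le' (show 3 ≤ j from hj2)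
    rw [elem_standard_add_three v (by omega), elem_standard_add_three v (by omega),
      Prod.mk_inj, mul_right_inj, SemidirectProduct.inr_inj, gen_injective.eq_iff, Fin.mk.injEq,
      pow_eq_pow_iff_modEq, orderOf_c] at h
    obtain ⟨hmod, hdiv⟩ := h
    rw [Nat.ModEq] at hmod
    omega

theorem nondegenerate_gridPartition (hk : 1 ≤ k) : Nondegenerate (gridPartition (k + 1)) := by
  refine ⟨fun i j h ↦ ?_, fun i j h ↦ ?_⟩ <;> replace h := congrArg (gamEquivModel hk) h
  · rw [gamEquivModel_a, gamEquivModel_a] at h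
    exact Fin.ext (elem_standard_injOn 1 i.is_le j.is_le h)
  · rw [gamEquivModel_b, gamEquivModel_b] at h
    exact Fin.ext (elem_standard_injOn (1, c) i.is_le j.is_le h)

theorem isULIE1Partition_gridPartition {n : ℕ} (hn : 2 ≤ n) :
    IsULIE1Partition (ZMod 2) (gridPartition n) := by
  obtain ⟨k, rfl⟩ := Nat.exists_eq_add_of_le' (show 1 ≤ n by omega)
  exact
    { two_le_left := by omega
      two_le_right := by omega
      nondegenerate := nondegenerate_gridPartition (by omega)
      minimallyRealizable := (isPairPartition_gridPartition (by omega)).minimallyRealizable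
      rowConnected := rowConnected_gridPartition (by omega)
      columnConnected := columnConnected_gridPartition (by omega) }

end Nondegeneracy

end ULIE

theorem mainTheorem5 (n : ℕ) (hn : 2 ≤ n) :
    ULIE.IsPairPartition (ULIE.gridPartition n) ∧
    ULIE.IsULIE1Partition (ZMod 2) (ULIE.gridPartition n) ∧
    ULIE.IsULIE1Group (ZMod 2) (2 * n + 1) (2 * n + 1) (ULIE.Gam (ULIE.gridPartition n)) ∧
    orderOf ULIE.alpha = 3 ∧
    (∃ e : ULIE.Gam (ULIE.gridPartition n) ≃* ULIE.Model (n - 1),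
      e (ULIE.a (ULIE.gridPartition n) ⟨1, by omega⟩) =
        (1, SemidirectProduct.inl (1, ULIE.c)) ∧
      e ((ULIE.a (ULIE.gridPartition n) ⟨1, by omega⟩)⁻¹ *
          ULIE.a (ULIE.gridPartition n) ⟨2, by omega⟩) =
        (1, SemidirectProduct.inl (ULIE.c, 1)) ∧
      ∀ k : Fin (n - 1),
        e (ULIE.a (ULIE.gridPartition n) ⟨2 * k.val + 3, by omega⟩) =
          (1, SemidirectProduct.inr (ULIE.gen k)) ∧
        e ((ULIE.a (ULIE.gridPartition n) ⟨2 * k.val + 3, by omega⟩)⁻¹ *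
            ULIE.a (ULIE.gridPartition n) ⟨2 * k.val + 4, by omega⟩) =
          (ULIE.c, 1)) ∧
    (3 ≤ n → ¬ ULIE.IsAmenable (ULIE.Gam (ULIE.gridPartition n))) ∧
    ULIE.IsSofic (ULIE.Gam (ULIE.gridPartition n)) := by
  have hpair := ULIE.isPairPartition_gridPartition (by omega : 1 ≤ n)
  have hULIE := ULIE.isULIE1Partition_gridPartition hn
  obtain ⟨k, rfl⟩ := Nat.exists_eq_add_of_le' (show 1 ≤ n by omega)
  have hk : 1 ≤ k := by omega
  let e := ULIE.gamEquivModel hk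
  have he := ULIE.gamEquivModel_a hk
  refine ⟨hpair, hULIE, ⟨_, hULIE, ⟨.refl _⟩⟩, ULIE.orderOf_alpha, ⟨e, he _, ?_, fun i ↦ ⟨?_, ?_⟩⟩,
    fun h3 hamenable ↦ ?_, ?_⟩
  · rw [map_mul, map_inv, he, he]
    exact inv_mul_cancel_left _ _
  · rw [he]
    exact (ULIE.ModelFamily.elem_two_mul_add_three _ 1 i).trans (one_mul _)
  · rw [map_mul, map_inv, he, he]
    exact ULIE.ModelFamily.elem_one_inv_mul_elem_one _ i
  · have hsurj : Function.Surjective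
        (SemidirectProduct.rightHom.comp ((MonoidHom.snd _ _).comp e.toMonoidHom)) :=
      SemidirectProduct.rightHom_surjective.comp (Prod.snd_surjective.comp e.surjective)
    exact ULIE.not_isAmenable_freeProdZ (by omega) (hamenable.of_surjective _ hsurj)
  · have := ULIE.residuallyFinite_of_injective e.toMonoidHom e.injective
    exact ULIE.isSofic_of_residuallyFinite _
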